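/- For a finite connected simple graph $G$ let $\operatorname{trs}(v)=\sum_{u} d_G(u,v)$ be the transmission of a vertex $v$, let $A(G)$ be the adjacency matrix, and let $A^{\operatorname{trs}}(G)=\operatorname{diag}(\operatorname{trs}(v))_v-A(G)$. The graph $G$ is called $t$-transmission regular if $\operatorname{trs}(v)=t$ for every vertex $v$. The Smith normal form (SNF) of an integer square matrix $M$ is the diagonal matrix $\operatorname{diag}(d_1,\dots,d_n)=PMQ$ with $P,Q$ integer matrices of determinant $\pm1$, all $d_i\ge 0$, and $d_i\mid d_{i+1}$ for $1\le i<n$. Write $x\mathbf 1_{(k)}$ for $k$ consecutive entries equal to $x$ (none if $k=0$). Let $m\ge 2$ and $s\ge 2$ be integers, and let $G$ be a $t$-transmission regular complete multipartite graph with exactly $m$ parts, each of size $s$. Then $t=ms+s-2$. Put $a=\gcd(m-1,2(s-1))$. If $m$ and $s$ are both even, then the SNF of $A^{\operatorname{trs}}(G)$ is $$\operatorname{diag}\Big(\mathbf 1_{(m-1)},\ a,\ t\,\mathbf 1_{(ms-2m)},\ 2t,\ t(t+s)\,\mathbf 1_{(m-2)},\ \frac{(s-1)t(t+s)}{a}\Big).$$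 Otherwise, the SNF of $A^{\operatorname{trs}}(G)$ is $$\operatorname{diag}\Big(\mathbf 1_{(m-1)},\ a,\ t\,\mathbf 1_{(ms-2m)},\ t,\ t(t+s)\,\mathbf 1_{(m-2)},\ \frac{2(s-1)t(t+s)}{a}\Big).$$ -/

import Mathlib

/-- `d` lists the diagonal entries of the Smith normal form over `ℤ` of the square matrix `M`:
the entries are nonnegative, each divides the next one, and, for some ordering `e` of the index
set, `M` is brought to `diag(d)` by multiplication on both sides with unimodular matrices. -/
def IsSmithNormalForm {V : Type*} [Fintype V] [DecidableEq V]
    (M : Matrix V V ℤ) (d : List ℤ) : Prop :=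
  (∀ x ∈ d, 0 ≤ x) ∧ d.IsChain (· ∣ ·) ∧
    ∃ (e : Fin d.length ≃ V) (P Q : Matrix (Fin d.length) (Fin d.length) ℤ),
      IsUnit P.det ∧ IsUnit Q.det ∧
        P * M.submatrix e e * Q = Matrix.diagonal (fun i => d.get i)

/-- The transmission of a vertex: the sum of its distances to all vertices. -/
noncomputable def SimpleGraph.transmission {V : Type*} [Fintype V] (G : SimpleGraph V)
    (v : V) : ℕ :=
  ∑ u : V, G.dist u v

/-- The transmission-adjacency matrix `diag(trs(G)) - A(G)`. -/
noncomputable def SimpleGraph.transAdjMatrix {V : Type*} [Fintype V] [DecidableEq V]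
    (G : SimpleGraph V) [DecidableRel G.Adj] : Matrix V V ℤ :=
  Matrix.diagonal (fun v => (G.transmission v : ℤ)) - G.adjMatrix ℤ

/-- `G` is `t`-transmission regular: every vertex has transmission `t`. -/
def SimpleGraph.IsTransmissionRegular {V : Type*} [Fintype V] (G : SimpleGraph V)
    (t : ℕ) : Prop :=
  ∀ v : V, G.transmission v = t

open Matrix Kronecker

/-! The matrix is `t • 1 + (1 - J_m) ⊗ J_s` with `J` all-ones. Adding `t • 1` forces similarity
rather than mere equivalence, and over `ℤ` the matrix `J_n` is similar to the matrix `R_n` with only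
`n, 1` in its top row. Replacing each `J` by `R` (`unimodularEquiv_allOnesReduced`) and relabelling
(`reduced_submatrix`) leaves a `4 × 4` core, `m - 2` copies of `!![t + s, 1; 0, t]`, and `m(s - 2)`
entries `t`. Each `2 × 2` block gives `1, t(t + s)`. With `p = 2(s - 1)/a` and `g = gcd(s, p)`, the
core gives `1, a, g t, (p/g) t (t + s)` (`equipartiteCore_unimodularEquiv`). Since `gcd(s, 2(s -
1))` divides `2`, `g` is `1` or `2`, and it is `2` exactly when `m` and `s` are both even. -/

/-- Two square integer matrices are equivalent if, up to a relabelling of the index set, one is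
obtained from the other by multiplying on both sides with unimodular matrices. -/
def Matrix.UnimodularEquiv {α β : Type*} [Fintype α] [DecidableEq α] [Fintype β] [DecidableEq β]
    (M : Matrix α α ℤ) (N : Matrix β β ℤ) : Prop :=
  ∃ (e : β ≃ α) (P Q : Matrix β β ℤ), IsUnit P.det ∧ IsUnit Q.det ∧ P * M.submatrix e e * Q = N

/-! ### Unimodular equivalence and its passage to Smith normal form. -/

namespace Matrix.UnimodularEquiv

variable {α β γ δ : Type*} [Fintype α] [DecidableEq α] [Fintype β] [DecidableEq β]
  [Fintype γ] [DecidableEq γ] [Fintype δ] [DecidableEq δ]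

theorem of_submatrix (M : Matrix α α ℤ) (e : β ≃ α) : UnimodularEquiv M (M.submatrix e e) :=
  ⟨e, 1, 1, by simp, by simp, by simp⟩

theorem of_mul {M N : Matrix α α ℤ} {P Q : Matrix α α ℤ} (hP : IsUnit P.det) (hQ : IsUnit Q.det)
    (h : P * M * Q = N) : UnimodularEquiv M N :=
  ⟨Equiv.refl α, P, Q, hP, hQ, by simpa using h⟩

theorem refl (M : Matrix α α ℤ) : UnimodularEquiv M M :=
  of_mul (P := 1) (Q := 1) (by simp) (by simp) (by simp)

theorem of_intertwine {M N W : Matrix α α ℤ} (hW : IsUnit W.det) (h : M * W = W * N) :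
    UnimodularEquiv M N :=
  of_mul (P := W⁻¹) (Q := W) (by simpa using hW) hW
    (by rw [Matrix.mul_assoc, h, ← Matrix.mul_assoc, Matrix.nonsing_inv_mul _ hW, Matrix.one_mul])

theorem trans {M : Matrix α α ℤ} {N : Matrix β β ℤ} {L : Matrix γ γ ℤ}
    (h₁ : UnimodularEquiv M N) (h₂ : UnimodularEquiv N L) : UnimodularEquiv M L := by
  obtain ⟨e, P, Q, hP, hQ, rfl⟩ := h₁
  obtain ⟨f, P', Q', hP', hQ', rfl⟩ := h₂
  refine ⟨f.trans e, P' * P.submatrix f f, Q.submatrix f f * Q', ?_, ?_, ?_⟩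
  · simpa using ⟨hP', hP⟩
  · simpa using ⟨hQ, hQ'⟩
  · rw [← Matrix.submatrix_mul_equiv _ _ _ f, ← Matrix.submatrix_mul_equiv _ _ _ f]
    simp [Matrix.mul_assoc, Matrix.submatrix_submatrix, Equiv.coe_trans]

theorem fromBlocks {A : Matrix α α ℤ} {B : Matrix β β ℤ} {C : Matrix γ γ ℤ} {D : Matrix δ δ ℤ}
    (h₁ : UnimodularEquiv A C) (h₂ : UnimodularEquiv B D) :
    UnimodularEquiv (Matrix.fromBlocks A 0 0 B) (Matrix.fromBlocks C 0 0 D) := by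
  obtain ⟨e, P, Q, hP, hQ, rfl⟩ := h₁
  obtain ⟨f, P', Q', hP', hQ', rfl⟩ := h₂
  refine ⟨e.sumCongr f, Matrix.fromBlocks P 0 0 P', Matrix.fromBlocks Q 0 0 Q', ?_, ?_, ?_⟩
  · simpa using ⟨hP, hP'⟩
  · simpa using ⟨hQ, hQ'⟩
  · have : (Matrix.fromBlocks A 0 0 B).submatrix (e.sumCongr f) (e.sumCongr f) =
        Matrix.fromBlocks (A.submatrix e e) 0 0 (B.submatrix f f) := by
      ext (i | i) (j | j) <;> simp
    rw [this]
    simp [Matrix.fromBlocks_multiply]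

theorem one_kronecker {A B P Q : Matrix α α ℤ} (hP : IsUnit P.det) (hQ : IsUnit Q.det)
    (h : P * A * Q = B) :
    UnimodularEquiv ((1 : Matrix β β ℤ) ⊗ₖ A) ((1 : Matrix β β ℤ) ⊗ₖ B) := by
  refine of_mul (P := (1 : Matrix β β ℤ) ⊗ₖ P) (Q := (1 : Matrix β β ℤ) ⊗ₖ Q) ?_ ?_ ?_
  · simpa [Matrix.det_kronecker] using hP.pow _
  · simpa [Matrix.det_kronecker] using hQ.pow _
  · rw [← Matrix.mul_kronecker_mul, ← Matrix.mul_kronecker_mul, h]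
    simp

end Matrix.UnimodularEquiv

/-- The values are collected as a sum of singletons so that the multiset splits along sum and
product index types. -/
theorem List.exists_equiv_get_of_multiset_eq {α β : Type*} [Fintype α] [DecidableEq α]
    (f : α → β) (d : List β) (h : ∑ i, ({f i} : Multiset β) = d) :
    ∃ e : Fin d.length ≃ α, ∀ i, f (e i) = d.get i := by
  have h' : (Finset.univ.val.map f : Multiset β) = d := by
    rw [← h, Finset.sum_eq_multiset_sum]
    conv_lhs => rw [← Multiset.sum_map_singleton (Multiset.map f _)]
    rw [Multiset.map_map]; rfl
  obtain ⟨l, hl⟩ := Quot.exists_rep (Finset.univ : Finset α).val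
  have hl : (l : Multiset α) = (Finset.univ : Finset α).val := hl
  rw [← hl, Multiset.map_coe, Multiset.coe_eq_coe] at h'
  obtain ⟨l', rfl, hl'⟩ : Relation.Comp (· = List.map f ·) List.Perm d l := by
    rw [List.eq_map_comp_perm]; exact h'.symm
  have hnd : l'.Nodup := by
    rw [hl'.nodup_iff, ← Multiset.coe_nodup, hl]; exact Finset.univ.nodup
  have hmem : ∀ x, x ∈ l' := fun x => by
    rw [hl'.mem_iff, ← Multiset.mem_coe, hl]; exact Finset.mem_univ x
  refine ⟨(finCongr (by simp)).trans (hnd.getEquivOfForallMemList _ hmem), fun i => ?_⟩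
  simp

/-- A matrix equivalent to a diagonal matrix has as Smith normal form any arrangement of the
diagonal entries into a divisibility chain. -/
theorem Matrix.UnimodularEquiv.isSmithNormalForm {V α : Type*} [Fintype V] [DecidableEq V]
    [Fintype α] [DecidableEq α] {M : Matrix V V ℤ} {f : α → ℤ} {d : List ℤ}
    (h : UnimodularEquiv M (Matrix.diagonal f)) (hd : ∑ i, ({f i} : Multiset ℤ) = d)
    (h0 : ∀ x ∈ d, 0 ≤ x) (hdvd : d.Pairwise (· ∣ ·)) : IsSmithNormalForm M d := by
  obtain ⟨e, he⟩ := List.exists_equiv_get_of_multiset_eq f d hd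
  obtain ⟨e', P, Q, hP, hQ, hPQ⟩ := h.trans (.of_submatrix _ e)
  refine ⟨h0, hdvd.isChain, e', P, Q, hP, hQ, hPQ.trans ?_⟩
  rw [Matrix.submatrix_diagonal_equiv]
  congr 1
  exact funext he

/-! ### Integral similarity class of the all-ones matrix. -/

section AllOnes

/-- The unimodular matrix that conjugates the all-ones matrix to `allOnesReduced`. -/
def allOnesBasis (κ : Type*) [DecidableEq κ] : Matrix (Fin 2 ⊕ κ) (Fin 2 ⊕ κ) ℤ :=
  Matrix.fromBlocks !![1, 0; 1, 1] (Matrix.of fun i _ => ![0, -1] i)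
    (Matrix.of fun _ j => ![1, 0] j) 1

/-- The matrix whose only nonzero entries are `n` and `1`, at the start of the first row. -/
def allOnesReduced (κ : Type*) (n : ℤ) : Matrix (Fin 2 ⊕ κ) (Fin 2 ⊕ κ) ℤ :=
  Matrix.fromBlocks !![n, 1; 0, 0] 0 0 0

variable {κ : Type*} [Fintype κ] [DecidableEq κ]

theorem isUnit_det_allOnesBasis : IsUnit (allOnesBasis κ).det := by
  rw [allOnesBasis, Matrix.det_fromBlocks_one₂₂, Matrix.det_fin_two]
  simp [Matrix.mul_apply]

/-- The basis consists of the all-ones vector, one coordinate vector `e`, and differences `e_k - e`.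
The all-ones matrix sends these to `n` times the first, to the first, and to `0`. -/
theorem allOnes_mul_basis :
    (Matrix.of fun _ _ => 1 : Matrix (Fin 2 ⊕ κ) (Fin 2 ⊕ κ) ℤ) * allOnesBasis κ =
      allOnesBasis κ * allOnesReduced κ (Fintype.card κ + 2) := by
  ext i (j | j)
  · fin_cases j <;> rcases i with i | i <;> (try fin_cases i) <;>
      simp [Matrix.mul_apply, allOnesBasis, allOnesReduced, add_comm]
  · rcases i with i | i <;> (try fin_cases i) <;>
      simp [Matrix.mul_apply, allOnesBasis, allOnesReduced, Matrix.one_apply]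

end AllOnes

/-! ### Block decomposition and the invariants of each block. -/

section Reduction

variable {κ ι : Type*} [DecidableEq κ] [DecidableEq ι]

/-- The `4 × 4` core of the transmission-adjacency matrix, where `c` is the transmission. -/
def equipartiteCore (m s c : ℤ) : Matrix (Fin 4) (Fin 4) ℤ :=
  !![c + s * (1 - m), -s, 1 - m, -1; 0, c + s, 0, 1; 0, 0, c, 0; 0, 0, 0, c]

theorem unimodularEquiv_allOnesReduced [Fintype κ] [Fintype ι] (c : ℤ) :
    UnimodularEquiv
      (c • 1 + (1 - Matrix.of fun _ _ => 1 : Matrix (Fin 2 ⊕ ι) (Fin 2 ⊕ ι) ℤ) ⊗ₖ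
        (Matrix.of fun _ _ => 1 : Matrix (Fin 2 ⊕ κ) (Fin 2 ⊕ κ) ℤ))
      (c • 1 + (1 - allOnesReduced ι (Fintype.card ι + 2)) ⊗ₖ
        allOnesReduced κ (Fintype.card κ + 2)) := by
  refine .of_intertwine (W := allOnesBasis ι ⊗ₖ allOnesBasis κ) ?_ ?_
  · rw [Matrix.det_kronecker]
    exact (isUnit_det_allOnesBasis.pow _).mul (isUnit_det_allOnesBasis.pow _)
  · rw [add_mul, mul_add, ← Matrix.mul_kronecker_mul, ← Matrix.mul_kronecker_mul,
      allOnes_mul_basis, sub_mul, mul_sub, allOnes_mul_basis, smul_mul_assoc, mul_smul_comm]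
    simp only [Matrix.one_mul, Matrix.mul_one]

/-- The relabelling that exhibits the block structure of the reduced matrix. -/
def coreIndexEquiv (ι κ : Type*) :
    Fin 4 ⊕ ((ι × Fin 2) ⊕ ((Fin 2 ⊕ ι) × κ)) ≃ (Fin 2 ⊕ ι) × (Fin 2 ⊕ κ) :=
  ((Equiv.sumAssoc _ _ _).symm.trans
    ((((finProdFinEquiv (m := 2) (n := 2)).symm.trans (Equiv.prodComm _ _)).sumCongr
      (Equiv.refl _)).trans (Equiv.sumProdDistrib _ _ _).symm |>.sumCongr (Equiv.refl _))).trans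
    (Equiv.prodSumDistrib _ _ _).symm

/-- `allOnesReduced` vanishes on every row and column outside `Fin 2`: an index in `κ` contributes
only `c`, and an index in `ι` sees `1 - R` as the identity. -/
theorem reduced_submatrix (m s c : ℤ) :
    (c • 1 + (1 - allOnesReduced ι m) ⊗ₖ allOnesReduced κ s).submatrix
        (coreIndexEquiv ι κ) (coreIndexEquiv ι κ) =
      Matrix.fromBlocks (equipartiteCore m s c) 0 0
        (Matrix.fromBlocks ((1 : Matrix ι ι ℤ) ⊗ₖ !![c + s, 1; 0, c]) 0 0
          (Matrix.diagonal fun _ => c)) := by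
  have h0 : coreIndexEquiv ι κ (Sum.inl 0) = (Sum.inl 0, Sum.inl 0) := rfl
  have h1 : coreIndexEquiv ι κ (Sum.inl 1) = (Sum.inl 1, Sum.inl 0) := rfl
  have h2 : coreIndexEquiv ι κ (Sum.inl 2) = (Sum.inl 0, Sum.inl 1) := rfl
  have h3 : coreIndexEquiv ι κ (Sum.inl 3) = (Sum.inl 1, Sum.inl 1) := rfl
  have h4 : ∀ i j, coreIndexEquiv ι κ (Sum.inr (Sum.inl (i, j))) = (Sum.inr i, Sum.inl j) :=
    fun _ _ => rfl
  have h5 : ∀ x, coreIndexEquiv ι κ (Sum.inr (Sum.inr x)) = (x.1, Sum.inr x.2) := fun _ => rfl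
  rw [Matrix.smul_one_eq_diagonal]
  ext (i | ⟨i, i'⟩ | ⟨i, i'⟩) (j | ⟨j, j'⟩ | ⟨j, j'⟩)
  · fin_cases i <;> fin_cases j <;>
      simp [h0, h1, h2, h3, allOnesReduced, equipartiteCore]
    ring
  · fin_cases i <;> fin_cases j' <;>
      simp [h0, h1, h2, h3, h4, allOnesReduced]
  · fin_cases i <;> simp [h0, h1, h2, h3, h5, allOnesReduced, Matrix.one_apply]
  · fin_cases i' <;> fin_cases j <;>
      simp [h0, h1, h2, h3, h4, allOnesReduced]
  · fin_cases i' <;> fin_cases j' <;>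
      simp [Matrix.diagonal_apply, h4, allOnesReduced, Matrix.one_apply] <;> split_ifs <;> simp_all
  · simp [h4, h5, allOnesReduced, Matrix.one_apply]
  · fin_cases j <;> simp [h0, h1, h2, h3, h5, allOnesReduced, Matrix.one_apply]
  · simp [h4, h5, allOnesReduced, Matrix.one_apply]
  · simp [Matrix.diagonal_apply, h5, allOnesReduced, Matrix.one_apply]

theorem equipartiteCore_unimodularEquiv {m s c a p q w x y g h k u v r : ℤ}
    (hc : c = s * m + s - 2) (hp : 2 * (s - 1) = a * p) (hq : m - 1 = a * q)
    (hw : c = a * w) (hxy : x * p + y * q = 1)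
    (hh : s = g * h) (hk : p = g * k) (huv : u * h + v * k = 1) (hr : c + s = g * r) :
    UnimodularEquiv (equipartiteCore m s c)
      (Matrix.diagonal ![a, 1, g * c, k * c * (c + s)]) := by
  have h₁ : c + s * (1 - m) = a * p := by linear_combination hc + hp
  have h₂ : 1 - m = -(a * q) := by linear_combination -hq
  have h₃ : c = a * p + s * (a * q) := by linear_combination h₁ - s * h₂
  -- Adding row 1 to row 0 gives `(a p, c, -a q, 0)`. Column 0 of `Q` uses `x p + y q = 1` to
  -- extract `a`; column 1 picks the pivot `1`. Columns 2 and 3 lie in the kernel of the top two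
  -- rows, where the third row takes the values `c (u s + v p) = g c` and `c (h p - k s) = 0`. The
  -- factors `w` and `r` in `P` clear what remains below the diagonal.
  refine .of_mul
    (P := !![1, 1, 0, 0; 0, 1, 0, 0; y * w, y * w, 1, 0;
      u * r * y * w, u * r * y * w - c, u * r, 1])
    (Q := !![x, 0, v * q - u, h * q + k; 0, 0, u, -k; -y, 0, u * s + v * p, h * p - k * s;
      0, 1, -(u * (c + s)), k * (c + s)]) ?_ ?_ ?_
  · simp [Matrix.det_succ_row_zero, Fin.sum_univ_succ, Fin.succAbove]
  · refine Int.isUnit_iff.2 (Or.inl ?_)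
    simp [Matrix.det_succ_row_zero, Fin.sum_univ_succ, Fin.succAbove]
    linear_combination (u * h + v * k) * hxy + huv
  · ext i j
    fin_cases i <;> fin_cases j <;>
      simp [equipartiteCore, Matrix.mul_apply, Fin.sum_univ_succ, Matrix.diagonal]
    · linear_combination x * h₁ - y * h₂ + a * hxy
    · linear_combination (v * q - u) * h₁ + (u * s + v * p) * h₂ + u * h₃
    · linear_combination (h * q + k) * h₁ + (h * p - k * s) * h₂ - k * h₃
    · ring
    · ring
    · linear_combination y * w * (x * h₁ - y * h₂ + a * hxy) - y * hw
    · linear_combination y * w * ((v * q - u) * h₁ + (u * s + v * p) * h₂ + u * h₃) +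
        c * (u * hh + v * hk + g * huv)
    · linear_combination y * w * ((h * q + k) * h₁ + (h * p - k * s) * h₂ - k * h₃) +
        c * (h * hk - k * hh)
    · linear_combination u * r * (y * w * (x * h₁ - y * h₂ + a * hxy) - y * hw)
    · linear_combination u * r * y * w *
        ((v * q - u) * h₁ + (u * s + v * p) * h₂ + u * h₃) +
        u * r * c * (u * hh + v * hk + g * huv) - c * u * hr
    · linear_combination u * r * y * w *
        ((h * q + k) * h₁ + (h * p - k * s) * h₂ - k * h₃) + u * r * c * (h * hk - k * hh)

/-- The off-diagonal `1` serves as pivot, leaving the determinant as the other invariant. -/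
theorem twoByTwo_kronecker_unimodularEquiv [Fintype ι] (c s : ℤ) :
    UnimodularEquiv ((1 : Matrix ι ι ℤ) ⊗ₖ !![c + s, 1; 0, c])
      (Matrix.diagonal fun x : ι × Fin 2 => ![1, c * (c + s)] x.2) := by
  have : (Matrix.diagonal fun x : ι × Fin 2 => ![1, c * (c + s)] x.2) =
      (1 : Matrix ι ι ℤ) ⊗ₖ Matrix.diagonal ![1, c * (c + s)] := by
    rw [← Matrix.diagonal_one, Matrix.diagonal_kronecker_diagonal]
    simp
  rw [this]
  refine .one_kronecker (P := !![1, 0; -c, 1]) (Q := !![0, -1; 1, c + s]) (by simp) (by simp) ?_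
  ext i j
  fin_cases i <;> fin_cases j <;> simp

/-- The Smith normal form of `c • 1 + (1 - J) ⊗ J`, given Bézout data for the two gcds
`a = gcd (m - 1) (2 * (s - 1))` and `g = gcd s (2 * (s - 1) / a)`. -/
theorem isSmithNormalForm_of_submatrix {V : Type*} [Fintype V] [DecidableEq V]
    {M : Matrix V V ℤ} {m' s' : ℕ} (e : (Fin 2 ⊕ Fin m') × (Fin 2 ⊕ Fin s') ≃ V)
    {m s c a p q w x y g h k u v r : ℤ}
    (hM : M.submatrix e e = c • 1 +
      (1 - Matrix.of fun _ _ => 1 : Matrix (Fin 2 ⊕ Fin m') (Fin 2 ⊕ Fin m') ℤ) ⊗ₖ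
        (Matrix.of fun _ _ => 1 : Matrix (Fin 2 ⊕ Fin s') (Fin 2 ⊕ Fin s') ℤ))
    (hm : m = m' + 2) (hs : s = s' + 2) (ha0 : 0 ≤ a) (hg0 : 0 ≤ g) (hk0 : 0 ≤ k) (hc0 : 0 ≤ c)
    (hc : c = s * m + s - 2) (hp : 2 * (s - 1) = a * p) (hq : m - 1 = a * q)
    (hw : c = a * w) (hxy : x * p + y * q = 1)
    (hh : s = g * h) (hk : p = g * k) (huv : u * h + v * k = 1) (hr : c + s = g * r) :
    IsSmithNormalForm M
      (List.replicate (m' + 1) 1 ++ [a] ++ List.replicate ((m' + 2) * s') c ++ [g * c] ++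
        List.replicate m' (c * (c + s)) ++ [k * c * (c + s)]) := by
  have h₁ := (UnimodularEquiv.of_submatrix M e).trans (hM ▸ unimodularEquiv_allOnesReduced c)
  have h₂ := h₁.trans (.of_submatrix _ (coreIndexEquiv (Fin m') (Fin s')))
  rw [reduced_submatrix] at h₂
  simp only [Fintype.card_fin, ← hm, ← hs] at h₂
  have h₃ := h₂.trans (.fromBlocks
    (equipartiteCore_unimodularEquiv hc hp hq hw hxy hh hk huv hr)
    (.fromBlocks (twoByTwo_kronecker_unimodularEquiv c s) (.refl _)))
  rw [Matrix.fromBlocks_diagonal, Matrix.fromBlocks_diagonal] at h₃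
  have hs0 : 0 ≤ s := by omega
  refine h₃.isSmithNormalForm ?_ ?_ ?_
  · simp only [Fintype.sum_sum_type, Fintype.sum_prod_type, Fin.sum_univ_four, Fin.sum_univ_two,
      ← Multiset.coe_add, Multiset.coe_replicate, ← Multiset.nsmul_singleton,
      Multiset.coe_singleton]
    simp [add_smul, mul_smul]
    simp only [← Multiset.singleton_add, smul_add]
    abel
  · simp only [List.mem_append, List.mem_replicate, List.mem_singleton]
    rintro z (((((⟨-, rfl⟩ | rfl) | ⟨-, rfl⟩) | rfl) | ⟨-, rfl⟩) | rfl) <;> positivity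
  · have hac : a ∣ c := ⟨w, hw⟩
    have hgc : g * c ∣ c * (c + s) := ⟨r, by rw [hr]; ring⟩
    have hkc : c * (c + s) ∣ k * c * (c + s) := ⟨k, by ring⟩
    have hcc : c ∣ c * (c + s) := ⟨_, rfl⟩
    have hcg : c ∣ g * c := ⟨g, mul_comm _ _⟩
    simp only [List.pairwise_append, List.pairwise_replicate, List.pairwise_singleton,
      List.mem_append, List.mem_replicate, List.mem_singleton, dvd_refl, or_true, true_and]
    refine ⟨⟨⟨⟨?_, ?_⟩, ?_⟩, ?_⟩, ?_⟩
    · rintro _ ⟨-, rfl⟩ _ -; exact one_dvd _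
    · rintro _ (⟨-, rfl⟩ | rfl) _ ⟨-, rfl⟩
      exacts [one_dvd _, hac]
    · rintro _ ((⟨-, rfl⟩ | rfl) | ⟨-, rfl⟩) _ rfl
      exacts [one_dvd _, hac.trans hcg, hcg]
    · rintro _ (((⟨-, rfl⟩ | rfl) | ⟨-, rfl⟩) | rfl) _ ⟨-, rfl⟩
      exacts [one_dvd _, hac.trans hcc, hcc, hgc]
    · rintro _ ((((⟨-, rfl⟩ | rfl) | ⟨-, rfl⟩) | rfl) | ⟨-, rfl⟩) _ rfl
      exacts [one_dvd _, hac.trans (hcc.trans hkc), hcc.trans hkc, hgc.trans hkc, hkc]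

end Reduction

/-! ### Distances and the matrix of the complete equipartite graph. -/

section Equipartite

variable {V : Type*} {G : SimpleGraph V} {m s : ℕ}

/-- Distinct vertices of one part have a common neighbour in another part, which exists because `m ≥
2`. -/
theorem dist_of_iso_completeEquipartiteGraph (hm : 2 ≤ m)
    (φ : G ≃g SimpleGraph.completeEquipartiteGraph m s) (x y : Fin m × Fin s) :
    G.dist (φ.symm x) (φ.symm y) = if x.1 = y.1 then (if x.2 = y.2 then 0 else 2) else 1 := by
  have hadj : ∀ x y, G.Adj (φ.symm x) (φ.symm y) ↔ x.1 ≠ y.1 := fun x y => by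
    rw [φ.symm.map_adj_iff, SimpleGraph.completeEquipartiteGraph_adj]
  split_ifs with h₁ h₂
  · rw [Prod.ext h₁ h₂, SimpleGraph.dist_self]
  · have : Nontrivial (Fin m) := Fin.nontrivial_iff_two_le.2 hm
    obtain ⟨i, hi⟩ := exists_ne x.1
    have hx : G.Adj (φ.symm x) (φ.symm (i, x.2)) := (hadj _ _).2 hi.symm
    have hy : G.Adj (φ.symm (i, x.2)) (φ.symm y) := (hadj _ _).2 (h₁ ▸ hi)
    refine le_antisymm (SimpleGraph.dist_le (.cons hx (.cons hy .nil))) ?_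
    refine (hx.reachable.trans hy.reachable).one_lt_dist_of_ne_of_not_adj ?_ ?_
    · exact fun h => h₂ (congrArg Prod.snd (φ.symm.injective h))
    · exact fun h => (hadj _ _).1 h h₁
  · exact SimpleGraph.dist_eq_one_iff_adj.2 ((hadj _ _).2 h₁)

theorem transmission_of_iso_completeEquipartiteGraph [Fintype V] (hm : 2 ≤ m)
    (φ : G ≃g SimpleGraph.completeEquipartiteGraph m s) (v : V) :
    G.transmission v + 2 = m * s + s := by
  obtain ⟨y, rfl⟩ := φ.symm.surjective v
  rw [SimpleGraph.transmission, ← φ.symm.toEquiv.sum_comp]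
  -- Adding `2` at the vertex itself makes the distance `1` plus the indicator of its part, which
  -- sums to `m * s + s`.
  have key : ∀ x : Fin m × Fin s, G.dist (φ.symm x) (φ.symm y) + (if x = y then 2 else 0) =
      1 + if x.1 = y.1 then 1 else 0 := fun x => by
    rw [dist_of_iso_completeEquipartiteGraph hm]
    simp only [Prod.ext_iff]
    split_ifs <;> simp_all
  have := Finset.sum_congr (rfl : (Finset.univ : Finset (Fin m × Fin s)) = Finset.univ)
    fun x _ => key x
  rw [Finset.sum_add_distrib, Finset.sum_add_distrib] at this
  have hpart : ∑ x : Fin m × Fin s, (if x.1 = y.1 then 1 else 0) = s := by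
    rw [Fintype.sum_prod_type_right]
    simp
  rw [hpart] at this
  simpa using this

/-- The adjacency matrix is `(J - 1) ⊗ J`. The index types stay free so that two indices can be
split off each factor. -/
theorem transAdjMatrix_submatrix [Fintype V] [DecidableEq V] [DecidableRel G.Adj] {t : ℕ} (ht : G.IsTransmissionRegular t)
    (φ : G ≃g SimpleGraph.completeEquipartiteGraph m s) {α β : Type*} [Fintype α] [DecidableEq α]
    [Fintype β] [DecidableEq β] (f : α ≃ Fin m) (g : β ≃ Fin s) :
    G.transAdjMatrix.submatrix ((f.prodCongr g).trans φ.symm.toEquiv)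
        ((f.prodCongr g).trans φ.symm.toEquiv) =
      (t : ℤ) • 1 + (1 - Matrix.of fun _ _ => 1 : Matrix α α ℤ) ⊗ₖ
        (Matrix.of fun _ _ => 1 : Matrix β β ℤ) := by
  ext ⟨i, i'⟩ ⟨j, j'⟩
  have hadj : G.Adj (φ.symm (f i, g i')) (φ.symm (f j, g j')) ↔ i ≠ j := by
    rw [φ.symm.map_adj_iff, SimpleGraph.completeEquipartiteGraph_adj]
    simp
  simp only [SimpleGraph.transAdjMatrix, ht _, Matrix.submatrix_apply, Matrix.sub_apply,
    Matrix.add_apply, Matrix.smul_apply, Matrix.diagonal_apply, SimpleGraph.adjMatrix_apply,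
    Matrix.kroneckerMap_apply, Matrix.of_apply, Matrix.one_apply,
    EmbeddingLike.apply_eq_iff_eq]
  simp [hadj]
  split_ifs <;> simp_all

end Equipartite

/-! ### The arithmetic of `a` and the parity cases. -/

theorem proposition4p6 {V : Type*} [Fintype V] [DecidableEq V]
    (G : SimpleGraph V) [DecidableRel G.Adj] (m s t : ℕ) (hm : 2 ≤ m) (hs : 2 ≤ s)
    (hG : Nonempty (G ≃g SimpleGraph.completeEquipartiteGraph m s))
    (ht : G.IsTransmissionRegular t) :
    t = m * s + s - 2 ∧
    ∀ a : ℕ, a = Nat.gcd (m - 1) (2 * (s - 1)) →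
      (Even m ∧ Even s →
        IsSmithNormalForm G.transAdjMatrix
          (List.replicate (m - 1) (1 : ℤ) ++ [(a : ℤ)] ++
            List.replicate (m * s - 2 * m) (t : ℤ) ++ [2 * (t : ℤ)] ++
            List.replicate (m - 2) ((t : ℤ) * (t + s)) ++
            [((s : ℤ) - 1) * t * (t + s) / a])) ∧
      (¬ (Even m ∧ Even s) →
        IsSmithNormalForm G.transAdjMatrix
          (List.replicate (m - 1) (1 : ℤ) ++ [(a : ℤ)] ++
            List.replicate (m * s - 2 * m) (t : ℤ) ++ [(t : ℤ)] ++
            List.replicate (m - 2) ((t : ℤ) * (t + s)) ++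
            [2 * ((s : ℤ) - 1) * t * (t + s) / a])) := by
  obtain ⟨φ⟩ := hG
  obtain ⟨m', rfl⟩ := Nat.exists_eq_add_of_le hm
  obtain ⟨s', rfl⟩ := Nat.exists_eq_add_of_le hs
  have ht2 : t + 2 = (2 + m') * (2 + s') + (2 + s') := by
    rw [← ht (φ.symm (⟨0, by omega⟩, ⟨0, by omega⟩))]
    exact transmission_of_iso_completeEquipartiteGraph hm φ _
  refine ⟨by omega, ?_⟩
  intro a ha
  have hM := transAdjMatrix_submatrix ht φ
    (finSumFinEquiv (m := 2) (n := m')) (finSumFinEquiv (m := 2) (n := s'))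
  have e₁ : 2 + m' - 1 = m' + 1 := by omega
  have e₂ : 2 + s' - 1 = s' + 1 := by omega
  have e₃ : 2 + m' - 2 = m' := by omega
  have e₄ : (2 + m') * (2 + s') - 2 * (2 + m') = (m' + 2) * s' := by
    rw [Nat.mul_add, Nat.mul_comm (2 + m') 2, Nat.add_sub_cancel_left, Nat.add_comm 2 m']
  rw [e₁, e₂] at ha
  rw [e₁, e₃, e₄]
  have ha0 : 0 < a := ha ▸ Nat.gcd_pos_of_pos_left _ (Nat.succ_pos _)
  have haz : (a : ℤ) ≠ 0 := by exact_mod_cast ha0.ne'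
  obtain ⟨q, hq⟩ : a ∣ m' + 1 := ha ▸ Nat.gcd_dvd_left _ _
  obtain ⟨p, hp⟩ : a ∣ 2 * (s' + 1) := ha ▸ Nat.gcd_dvd_right _ _
  have hqz : (m' : ℤ) + 1 = a * q := by exact_mod_cast hq
  have hpz : 2 * ((s' : ℤ) + 1) = a * p := by exact_mod_cast hp
  obtain ⟨x, y, hxy⟩ : ∃ x y : ℤ, x * p + y * q = 1 := by
    have h := Nat.gcd_eq_gcd_ab (m' + 1) (2 * (s' + 1))
    rw [← ha] at h
    push_cast at h
    refine ⟨_, _, mul_left_cancel₀ haz (?_ : (a : ℤ) * (Nat.gcdB (m' + 1) (2 * (s' + 1)) * p +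
      Nat.gcdA (m' + 1) (2 * (s' + 1)) * q) = a * 1)⟩
    rw [hqz, hpz] at h
    linear_combination -h
  have htz : (t : ℤ) + 2 = (2 + m') * (2 + s') + (2 + s') := by exact_mod_cast ht2
  have hc : (t : ℤ) = (s' + 2) * (m' + 2) + (s' + 2) - 2 := by linear_combination htz
  have hw : (t : ℤ) = a * ((s' + 2) * q + p) := by
    linear_combination hc + (s' + 2 : ℤ) * hqz + hpz
  push_cast
  constructor
  · rintro ⟨hme, hse⟩
    obtain ⟨h, hh⟩ : ∃ h, s' + 2 = 2 * h := by
      obtain ⟨h, hh⟩ := hse; exact ⟨h, by omega⟩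
    have hao : Odd a := by
      refine Nat.Odd.of_mul_left (n := q) ?_
      rw [← hq]
      obtain ⟨j, hj⟩ := hme
      exact ⟨j - 1, by omega⟩
    obtain ⟨k, hk⟩ : 2 ∣ p := (Nat.coprime_two_left.2 hao).dvd_of_dvd_mul_left ⟨_, hp.symm⟩
    have hhz : (s' : ℤ) + 2 = 2 * h := by exact_mod_cast hh
    have hkz : (p : ℤ) = 2 * k := by exact_mod_cast hk
    have hak : (s' : ℤ) + 1 = a * k := by
      rw [hkz] at hpz; linarith
    -- Here `g = 2`, with Bézout relation `2 h - a k = s - (s - 1) = 1`.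
    have hsnf := isSmithNormalForm_of_submatrix (m := m' + 2) (s := s' + 2) (a := a) (p := p)
      (q := q) (g := 2) (h := h) (k := k) (u := 2) (v := -a) (r := h * (m' + 3) - 1 + h) _ hM
      rfl rfl (by positivity) (by norm_num) (by positivity) (by positivity) hc
      (by linear_combination hpz) (by linear_combination hqz) hw hxy hhz hkz
      (by linear_combination hak - hhz) (by linear_combination hc + (m' + 4) * hhz)
    convert hsnf using 3
    · ring_nf
    · refine Int.ediv_eq_of_eq_mul_right haz ?_
      linear_combination (t : ℤ) * (t + (2 + s')) * hak
  · intro hodd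
    -- Here `g = 1`. Since `2 = 2 s - a p` is a combination of `s` and `p`, it suffices that one of
    -- them is odd: subtracting multiples of `2` from it reaches `1`. If `s` is even then `m` is
    -- odd, so `a` is even and `p` divides the odd number `s - 1`.
    obtain ⟨u, v, huv⟩ : ∃ u v : ℤ, u * (s' + 2) + v * p = 1 := by
      rcases Nat.even_or_odd s' with hse | ⟨j, hj⟩
      · have hmo : ¬ Even (2 + m') := fun h => hodd ⟨h, even_two.add hse⟩
        obtain ⟨b, hb⟩ : 2 ∣ a := by
          rw [ha]
          refine Nat.dvd_gcd ?_ ⟨_, rfl⟩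
          obtain ⟨i, hi⟩ := Nat.not_even_iff_odd.1 hmo
          exact ⟨i, by omega⟩
        have hbp : s' + 1 = b * p := by
          rw [hb, Nat.mul_assoc] at hp; omega
        have hpo : Odd p := by
          refine Nat.Odd.of_mul_right (m := b) ?_
          rw [← hbp]; exact hse.add_one
        obtain ⟨j, hj⟩ := hpo
        have hjz : (p : ℤ) = 2 * j + 1 := by exact_mod_cast hj
        exact ⟨-2 * j, 1 + j * a, by linear_combination hjz - j * hpz⟩
      · have hjz : (s' : ℤ) = 2 * j + 1 := by exact_mod_cast hj
        exact ⟨1 - 2 * (j + 1), (j + 1) * a, by linear_combination hjz - (j + 1) * hpz⟩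
    have hsnf := isSmithNormalForm_of_submatrix (m := m' + 2) (s := s' + 2) (a := a) (p := p)
      (q := q) (g := 1) (h := s' + 2) (k := p) (u := u) (v := v) (r := t + (s' + 2)) _ hM
      rfl rfl (by positivity) (by norm_num) (by positivity) (by positivity) hc
      (by linear_combination hpz) (by linear_combination hqz) hw hxy (by ring) (by ring)
      huv (by ring)
    convert hsnf using 3
    · ring_nf
    · ring_nf
    · refine Int.ediv_eq_of_eq_mul_right haz ?_
      linear_combination (t : ℤ) * (t + (2 + s')) * hpz
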